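/- All spaces are connected (Hausdorff) CW complexes and all maps are continuous. For a space $Z$ and $n\ge 1$ let $\mathcal B_n(Z)$ be the space of probability measures $\mu=\sum_{i=1}^n a_i\delta_{z_i}$ on $Z$ supported by at most $n$ points, with the topology of weak convergence (for metrizable $Z$ this is the topology of the Lévy–Prokhorov metric). For a map $p\colon E\to B$ let $E_n\subset\mathcal B_n(E)$ be the subspace of those $\mu$ whose support lies in a single fibre of $p$, and let $p_n\colon E_n\to B$ send a measure supported in $p^{-1}(b)$ to $b$. Let $X$ be a space with base point $x_0$, let $P_0(X)=\{\varphi\colon[0,1]\to X \mid \varphi(1)=x_0\}$ with the compact-open topology, let $e^X\colon P_0(X)\to X$, $e^X(\varphi)=\varphi(0)$, and let $q^X\colon\widetilde X\to X$ be the universal covering. For a map $f\colon Y\to X$, the distributional category $\mathrm{dcat}(f)$ (respectively the distributional one-category $\mathrm{dcat}_1(f)$) is the least integer $n\ge 0$ such that $f$ lifts along $e^X_{n+1}\colon P_0(X)_{n+1}\to X$ (respectively along $q^X_{n+1}\colon\widetilde X_{n+1}\to X$), and $\infty$ if there is no such $n$. Put $\mathrm{dcat}(X)=\mathrm{dcat}(1_X)$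 and $\mathrm{dcat}_1(X)=\mathrm{dcat}_1(1_X)$. Let $\pi$ be a discrete group and let $K=K(\pi,1)$, that is, $K$ has fundamental group isomorphic to $\pi$ and contractible universal cover. A map $\kappa\colon Y\to K$ classifies the universal cover of $Y$ if the pullback along $\kappa$ of the universal covering of $K$ is isomorphic, over $Y$, to the universal covering of $Y$. Statement. 1. If $\kappa\colon Y\to K(\pi,1)$ classifies the universal cover of $Y$, then $$\mathrm{dcat}_1(Y)=\mathrm{dcat}_1(\kappa)=\mathrm{dcat}(\kappa).$$ 2. For every map $f\colon Y\to K(\pi,1)$, $\mathrm{dcat}_1(f)=\mathrm{dcat}(f)$. 3. In particular, $\mathrm{dcat}_1(K)=\mathrm{dcat}(K)$ for every $K=K(\pi,1)$, that is, $\mathrm{dcat}_1(\pi)=\mathrm{dcat}(\pi)$, where $\mathrm{dcat}_1(\pi)$ and $\mathrm{dcat}(\pi)$ denote the values of these invariants on $K(\pi,1)$. -/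

import Mathlib

open MeasureTheory

namespace DistCat

noncomputable section

universe u v w

/-! ### Finitely supported distributions -/

/-- `Distribution n Z` is the space of Borel probability measures `μ` on `Z` that can be written as
a formal sum `a₁ δ_{z₁} + ⋯ + aₙ δ_{zₙ}` of at most `n` point masses. -/
def Distribution (n : ℕ) (Z : Type u) [TopologicalSpace Z] : Type u :=
  {μ : @ProbabilityMeasure Z (borel Z) //
    ∃ (a : Fin n → NNReal) (z : Fin n → Z),
      (μ : @Measure Z (borel Z)) = ∑ i, a i • @Measure.dirac Z (borel Z) (z i)}

/-- The topology of weak convergence of probability measures. When `Z` is metrizable, this is the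
topology on `Distribution n Z` of the Lévy-Prokhorov metric of any metric that induces the topology
of `Z`: the two topologies agree at every measure with separable support. -/
instance instTopologicalSpaceDistribution (n : ℕ) (Z : Type u) [TopologicalSpace Z] :
    TopologicalSpace (Distribution n Z) :=
  letI : MeasurableSpace Z := borel Z
  haveI : BorelSpace Z := ⟨rfl⟩
  TopologicalSpace.induced (fun μ : Distribution n Z => (μ.1 : ProbabilityMeasure Z)) inferInstance

/-- The support of a finitely supported distribution: the set of its atoms. -/
def Distribution.supp {n : ℕ} {Z : Type u} [TopologicalSpace Z] (μ : Distribution n Z) : Set Z :=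
  {z | (μ.1 : @Measure Z (borel Z)) {z} ≠ 0}

theorem Distribution.supp_nonempty {n : ℕ} {Z : Type u} [TopologicalSpace Z]
    (μ : Distribution n Z) : μ.supp.Nonempty := by
  let _ : MeasurableSpace Z := borel Z
  obtain ⟨μ, a, z, h⟩ := μ
  have hi : ∃ i, a i ≠ 0 := by
    by_contra hcon
    push Not at hcon
    have h1 : (μ : Measure Z) Set.univ = 1 := measure_univ
    rw [h] at h1
    simp [hcon] at h1
  obtain ⟨i, hi⟩ := hi
  refine ⟨z i, fun h0 => hi ?_⟩
  change (μ : Measure Z) {z i} = 0 at h0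
  rw [h, Measure.finsetSum_apply, Finset.sum_eq_zero_iff] at h0
  have h2 := h0 i (Finset.mem_univ i)
  rw [Measure.smul_apply, Measure.dirac_apply_of_mem (Set.mem_singleton _)] at h2
  simpa [ENNReal.smul_def] using h2

/-! ### The fibrewise construction and lifts -/

section Fiberwise

variable {E : Type u} {B : Type v} [TopologicalSpace E] [TopologicalSpace B]

/-- For `p : E → B`, the subspace `Eₙ` of the space of distributions on `E` with at most `n` atoms
that consists of the distributions supported in a single fibre of `p`. -/
def FiberDistribution (p : C(E, B)) (n : ℕ) : Type u :=
  {μ : Distribution n E // ∃ b : B, μ.supp ⊆ p ⁻¹' {b}}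

instance instTopologicalSpaceFiberDistribution (p : C(E, B)) (n : ℕ) :
    TopologicalSpace (FiberDistribution p n) :=
  inferInstanceAs (TopologicalSpace {μ : Distribution n E // ∃ b : B, μ.supp ⊆ p ⁻¹' {b}})

/-- The projection `pₙ : Eₙ → B`, sending a distribution supported in the fibre over `b` to `b`. -/
def FiberDistribution.proj {p : C(E, B)} {n : ℕ} (μ : FiberDistribution p n) : B :=
  μ.2.choose

theorem FiberDistribution.proj_eq_iff {p : C(E, B)} {n : ℕ} (μ : FiberDistribution p n) (b : B) :
    μ.proj = b ↔ μ.1.supp ⊆ p ⁻¹' {b} := by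
  have h : μ.1.supp ⊆ p ⁻¹' {μ.proj} := μ.2.choose_spec
  refine ⟨fun hb => hb ▸ h, fun hb => ?_⟩
  obtain ⟨z, hz⟩ := μ.1.supp_nonempty
  have h1 : p z = μ.proj := h hz
  have h2 : p z = b := hb hz
  exact h1.symm.trans h2

/-- The map `f : A → B` has a lift `g` along `pₙ : Eₙ → B`, that is, `pₙ ∘ g = f`. -/
def HasDistLift {A : Type w} [TopologicalSpace A] (p : C(E, B)) (n : ℕ) (f : C(A, B)) : Prop :=
  ∃ g : C(A, FiberDistribution p n), ∀ a, (g a).proj = f a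

/-- The least `n` such that `f` has a lift along `pₙ₊₁ : Eₙ₊₁ → B` (`⊤` if there is none). -/
def distLiftNumber {A : Type w} [TopologicalSpace A] (p : C(E, B)) (f : C(A, B)) : ℕ∞ :=
  sInf {m : ℕ∞ | ∃ n : ℕ, m = n ∧ HasDistLift p (n + 1) f}

end Fiberwise

/-! ### Distributional category -/

/-- The based path space: paths in `X` that end at `x₀`, with the compact-open topology. -/
def BasedPath (X : Type u) [TopologicalSpace X] (x₀ : X) : Type u :=
  {φ : C(unitInterval, X) // φ 1 = x₀}

instance instTopologicalSpaceBasedPath (X : Type u) [TopologicalSpace X] (x₀ : X) :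
    TopologicalSpace (BasedPath X x₀) :=
  inferInstanceAs (TopologicalSpace {φ : C(unitInterval, X) // φ 1 = x₀})

/-- The evaluation fibration `φ ↦ φ 0` of the based path space. -/
def evalZero (X : Type u) [TopologicalSpace X] (x₀ : X) : C(BasedPath X x₀, X) where
  toFun φ := φ.1 0
  continuous_toFun := (continuous_eval_const (0 : unitInterval)).comp continuous_subtype_val

/-- The distributional category of a map `f : Y → X`, for the base point `x₀` of `X`. -/
def dcat {X : Type u} {Y : Type v} [TopologicalSpace X] [TopologicalSpace Y] (x₀ : X)
    (f : C(Y, X)) : ℕ∞ :=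
  distLiftNumber (evalZero X x₀) f

/-! ### Universal coverings and distributional one-category -/

/-- `q : E → X` is a universal covering: a covering map with simply connected total space
(simply connected spaces are nonempty and path connected). -/
structure IsUniversalCovering {E : Type u} {X : Type v} [TopologicalSpace E] [TopologicalSpace X]
    (q : C(E, X)) : Prop where
  isCoveringMap : IsCoveringMap q
  simplyConnectedSpace : SimplyConnectedSpace E

/-- The distributional one-category of a map `f : Y → X`, computed with the universal covering
`q : E → X`. -/
def dcatOne {E : Type u} {X : Type v} {Y : Type w} [TopologicalSpace E] [TopologicalSpace X]
    [TopologicalSpace Y] (q : C(E, X)) (f : C(Y, X)) : ℕ∞ :=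
  distLiftNumber q f

/-- `K` is a `K(π, 1)`: a path connected space with fundamental group isomorphic to `π` that has a
contractible universal covering space. -/
structure IsEilenbergMacLaneOne (π : Type w) [Group π] (K : Type u) [TopologicalSpace K] :
    Prop where
  pathConnectedSpace : PathConnectedSpace K
  fundamentalGroup : ∀ k : K, Nonempty (FundamentalGroup K k ≃* π)
  contractible_cover : ∃ (E : Type u) (_ : TopologicalSpace E) (q : C(E, K)),
    IsUniversalCovering q ∧ ContractibleSpace E

/-- `κ : Y → K` classifies the universal covering `qY` of `Y`: the pullback along `κ` of the
universal covering `qK` of `K` is isomorphic to `qY`, as a space over `Y`. -/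
def ClassifiesUniversalCovering {Y' Y K' K : Type*} [TopologicalSpace Y'] [TopologicalSpace Y]
    [TopologicalSpace K'] [TopologicalSpace K] (qY : C(Y', Y)) (qK : C(K', K)) (κ : C(Y, K)) :
    Prop :=
  ∃ h : Y' ≃ₜ {x : Y × K' // κ x.1 = qK x.2}, ∀ y' : Y', (h y').1.1 = qY y'

end

end DistCat

/-! Fibrewise lifts push forward along maps of total spaces over a map of bases (`HasDistLift.map`).
So `dcatOne` and `dcat` agree on all maps into `K` once there are maps over `K` in both directions
between the based path space and `K'`. One lifts each path backwards from its end point. The other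
projects to `K` the track of a point under a contraction of `K'`; this covering is contractible
because it is homeomorphic over `K` to the given contractible one (`dcatOne_eq_dcat`).

For a classifying map `κ`, pushing forward along `Y' ≅ κ^*K' → K'` gives one inequality. Conversely,
weighted points `z i` of `K'` over `κ y` give points `(y, z i)` of the pullback, and the issue is
weak continuity there (`continuous_pullback`), since a test function `F` on the pullback also
depends on `y`. Near `y₀` almost all the mass lies on the finitely many sheets that meet the support
at `y₀`. On a sheet, `F` is a function of `y` alone, and bump functions on `K'` measure the mass of
each sheet. The bumps require complete regularity of `K`, which comes from normality of CW
complexes, by induction over skeleta with Tietze extension on each cell. -/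

/-! ### Normality of CW complexes -/

namespace CWNormal

open Set Metric Topology CWComplex

variable {X : Type*} [TopologicalSpace X]

/-- `f` separates `s` and `t` on `A`: it is continuous on the closed set `A`, zero on `s ∩ A` and
one on `t ∩ A`. -/
structure SeparatesOn (s t A : Set X) (f : X → ℝ) : Prop where
  continuousOn : ContinuousOn f A
  eq_zero : ∀ x ∈ s ∩ A, f x = 0
  eq_one : ∀ x ∈ t ∩ A, f x = 1

/-- A separating function on the boundary of a ball, pulled back along a map `φ` that is continuous
on the closed ball, extends to a continuous function on the whole space that separates on the closed
ball. -/
theorem SeparatesOn.exists_extend_ball {s t A : Set X} (hs : IsClosed s) (ht : IsClosed t)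
    (hst : Disjoint s t) {f : X → ℝ} (hf : SeparatesOn s t A f) {n : ℕ} {φ : (Fin n → ℝ) → X}
    (hφ : ContinuousOn φ (closedBall 0 1)) (hφA : MapsTo φ (sphere 0 1) A) :
    ∃ g : C(Fin n → ℝ, ℝ), (∀ v ∈ sphere 0 1, g v = f (φ v)) ∧
      SeparatesOn (φ ⁻¹' s) (φ ⁻¹' t) (closedBall 0 1) g := by
  classical
  set S := closedBall (0 : Fin n → ℝ) 1 ∩ φ ⁻¹' s with hS
  set T := closedBall (0 : Fin n → ℝ) 1 ∩ φ ⁻¹' t with hT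
  have hSc : IsClosed S := hφ.preimage_isClosed_of_isClosed isClosed_closedBall hs
  have hTc : IsClosed T := hφ.preimage_isClosed_of_isClosed isClosed_closedBall ht
  -- Only the values of `h` on the closed set `sphere ∪ S ∪ T` matter; its restriction to that set
  -- is extended by Tietze's theorem.
  let h : (Fin n → ℝ) → ℝ := fun v => if v ∈ sphere (0 : Fin n → ℝ) 1 then f (φ v) else
    if φ v ∈ s then 0 else 1
  have h0 : EqOn h (fun v => f (φ v)) (sphere 0 1) := fun v hv => if_pos hv
  have hhS : EqOn h (fun _ => 0) S := fun v hv => by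
    by_cases hvs : v ∈ sphere (0 : Fin n → ℝ) 1
    · rw [h0 hvs]
      exact hf.eq_zero _ ⟨hv.2, hφA hvs⟩
    · simp only [h, if_neg hvs]
      exact if_pos hv.2
  have hhT : EqOn h (fun _ => 1) T := fun v hv => by
    by_cases hvs : v ∈ sphere (0 : Fin n → ℝ) 1
    · rw [h0 hvs]
      exact hf.eq_one _ ⟨hv.2, hφA hvs⟩
    · simp only [h, if_neg hvs]
      exact if_neg (fun hm => Set.disjoint_left.1 hst hm hv.2)
  have hc0 : ContinuousOn h (sphere 0 1) :=
    (hf.continuousOn.comp (hφ.mono sphere_subset_closedBall) hφA).congr h0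
  have hc : ContinuousOn h (sphere 0 1 ∪ S ∪ T) :=
    ((hc0.union_of_isClosed (continuousOn_const.congr hhS) isClosed_sphere hSc).union_of_isClosed
      (continuousOn_const.congr hhT) (isClosed_sphere.union hSc) hTc)
  obtain ⟨g, hg⟩ := ContinuousMap.exists_restrict_eq ((isClosed_sphere.union hSc).union hTc)
    ⟨_, hc.domRestrict⟩
  have hg' : ∀ v ∈ sphere 0 1 ∪ S ∪ T, g v = h v := fun v hv => DFunLike.congr_fun hg ⟨v, hv⟩
  refine ⟨g, fun v hv => (hg' v (.inl (.inl hv))).trans (h0 hv), g.continuous.continuousOn,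
    fun v hv => ?_, fun v hv => ?_⟩
  · exact (hg' v (.inl (.inr ⟨hv.2, hv.1⟩))).trans (hhS ⟨hv.2, hv.1⟩)
  · exact (hg' v (.inr ⟨hv.2, hv.1⟩)).trans (hhT ⟨hv.2, hv.1⟩)

variable [T2Space X] [CWComplex (univ : Set X)]

/-- The part of the CW complex `X` that consists of the cells of dimension less than `n`. -/
abbrev skel (X : Type*) [TopologicalSpace X] [T2Space X] [CWComplex (univ : Set X)] (n : ℕ) :
    Set X :=
  (skeletonLT (univ : Set X) (n : ℕ∞) : Set X)

theorem isClosed_skel (n : ℕ) : IsClosed (skel X n) :=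
  RelCWComplex.Subcomplex.closed _

/-- The extensions over the separate `n`-cells agree with `f` on the cell frontiers and are glued.
Closedness of preimages is then tested cell by cell. -/
theorem SeparatesOn.exists_extend_skel {s t : Set X} (hs : IsClosed s) (ht : IsClosed t)
    (hst : Disjoint s t) {n : ℕ} {f : X → ℝ} (hf : SeparatesOn s t (skel X n) f) :
    ∃ f' : X → ℝ, EqOn f' f (skel X n) ∧ SeparatesOn s t (skel X (n + 1)) f' := by
  classical
  have hfr : ∀ j : cell (univ : Set X) n, MapsTo (map n j) (sphere 0 1) (skel X n) := fun j =>
    mapsTo_iff_image_subset.2 (cellFrontier_subset_skeletonLT n j)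
  choose g hg hgs using fun j : cell (univ : Set X) n =>
    hf.exists_extend_ball hs ht hst (RelCWComplex.continuousOn n j) (hfr j)
  let f' : X → ℝ := fun x => if x ∈ skel X n then f x else
    if h : ∃ j : cell (univ : Set X) n, x ∈ openCell n j then
      g h.choose ((map n h.choose).symm x) else 0
  have heq : EqOn f' f (skel X n) := fun x hx => if_pos hx
  have hmap : ∀ (j : cell (univ : Set X) n), ∀ v ∈ closedBall (0 : Fin n → ℝ) 1,
      f' (map n j v) = g j v := by
    intro j v hv
    rw [← sphere_union_ball] at hv
    rcases hv with hv | hv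
    · rw [heq (hfr j hv), hg j v hv]
    · have hx : map n j v ∈ openCell n j := mem_image_of_mem _ hv
      have hns : map n j v ∉ skel X n := fun h =>
        Set.disjoint_left.1 (disjoint_skeletonLT_openCell le_rfl) h hx
      have hex : ∃ j' : cell (univ : Set X) n, map n j v ∈ openCell n j' := ⟨j, hx⟩
      have hj : hex.choose = j := by
        have := RelCWComplex.eq_of_not_disjoint_openCell (C := (univ : Set X))
          (Set.not_disjoint_iff.2 ⟨_, hex.choose_spec, hx⟩)
        simpa using this
      simp only [f', if_neg hns, dif_pos hex]
      rw [hj, (map n j).left_inv (by rwa [source_eq])]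
  have hcell : ∀ x ∈ skel X (n + 1), x ∈ skel X n ∨
      ∃ j : cell (univ : Set X) n, ∃ v ∈ closedBall (0 : Fin n → ℝ) 1, x = map n j v := by
    intro x hx
    obtain ⟨m, hm, j, hxj⟩ := CWComplex.mem_skeletonLT_iff.1 hx
    have hm' : m < n + 1 := by exact_mod_cast hm
    rcases Nat.lt_succ_iff_lt_or_eq.1 hm' with h | rfl
    · exact .inl (CWComplex.mem_skeletonLT_iff.2 ⟨m, by exact_mod_cast h, j, hxj⟩)
    · obtain ⟨v, hv, rfl⟩ := hxj
      exact .inr ⟨j, v, ball_subset_closedBall hv, rfl⟩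
  refine ⟨f', heq, ?_, ?_, ?_⟩
  · refine continuousOn_iff_isClosed.2 fun Z hZ => ⟨f' ⁻¹' Z ∩ skel X (n + 1), ?_, by
      rw [inter_assoc, inter_self]⟩
    refine CWComplex.isClosed_of_disjoint_openCell_or_isClosed_inter_closedCell
      (C := (univ : Set X)) (subset_univ _) fun m _ j => ?_
    rcases lt_trichotomy m n with hm | rfl | hm
    · right
      have hsub : closedCell m j ⊆ skel X n :=
        (closedCell_subset_skeletonLT m j).trans (skeletonLT_mono (by exact_mod_cast hm))
      have hsub' : closedCell m j ⊆ skel X (n + 1) :=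
        hsub.trans (skeletonLT_mono (by exact_mod_cast n.le_succ))
      have : f' ⁻¹' Z ∩ skel X (n + 1) ∩ closedCell m j =
          (skel X n ∩ f ⁻¹' Z) ∩ closedCell m j := by
        ext x
        constructor
        · rintro ⟨⟨h1, -⟩, h3⟩
          exact ⟨⟨hsub h3, by rw [mem_preimage, ← heq (hsub h3)]; exact h1⟩, h3⟩
        · rintro ⟨⟨h1, h2⟩, h3⟩
          exact ⟨⟨by rw [mem_preimage, heq h1]; exact h2, hsub' h3⟩, h3⟩
      rw [this]
      exact (hf.continuousOn.preimage_isClosed_of_isClosed (isClosed_skel n) hZ).inter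
        isClosed_closedCell
    · right
      have : f' ⁻¹' Z ∩ skel X (m + 1) ∩ closedCell m j =
          map m j '' (closedBall 0 1 ∩ g j ⁻¹' Z) := by
        ext x
        constructor
        · rintro ⟨⟨h1, -⟩, v, hv, rfl⟩
          exact ⟨v, ⟨hv, by rw [mem_preimage, ← hmap j v hv]; exact h1⟩, rfl⟩
        · rintro ⟨v, ⟨hv, h2⟩, rfl⟩
          exact ⟨⟨by rw [mem_preimage, hmap j v hv]; exact h2,
            closedCell_subset_skeletonLT m j ⟨v, hv, rfl⟩⟩, v, hv, rfl⟩
      -- The image of a compact set in a Hausdorff space is closed.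
      rw [this]
      exact (((isCompact_closedBall _ _).inter_right
        (hZ.preimage (g j).continuous)).image_of_continuousOn
        ((RelCWComplex.continuousOn m j).mono inter_subset_left)).isClosed
    · left
      exact Disjoint.mono_left inter_subset_right
        (disjoint_skeletonLT_openCell (by exact_mod_cast hm))
  · rintro x ⟨hxs, hx⟩
    rcases hcell x hx with h | ⟨j, v, hv, rfl⟩
    · rw [heq h]
      exact hf.eq_zero x ⟨hxs, h⟩
    · rw [hmap j v hv]
      exact (hgs j).eq_zero v ⟨hxs, hv⟩
  · rintro x ⟨hxs, hx⟩
    rcases hcell x hx with h | ⟨j, v, hv, rfl⟩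
    · rw [heq h]
      exact hf.eq_one x ⟨hxs, h⟩
    · rw [hmap j v hv]
      exact (hgs j).eq_one v ⟨hxs, hv⟩

/-- Disjoint closed sets of a CW complex are separated by a continuous function. -/
theorem exists_separatesOn_univ {s t : Set X} (hs : IsClosed s) (ht : IsClosed t)
    (hst : Disjoint s t) : ∃ f : X → ℝ, SeparatesOn s t univ f := by
  classical
  have h0 : skel X 0 = ∅ := by
    rw [skel, Nat.cast_zero]
    exact CWComplex.skeletonLT_zero_eq_empty
  choose next hnext hsep using fun (n : ℕ) (f : {f : X → ℝ // SeparatesOn s t (skel X n) f}) =>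
    f.2.exists_extend_skel hs ht hst
  -- `skel X 0` is empty, as it has only the cells of negative dimension, so the recursion may start
  -- from the zero function.
  let F : (n : ℕ) → {f : X → ℝ // SeparatesOn s t (skel X n) f} := fun n =>
    Nat.rec ⟨0, by rw [h0]; exact ⟨continuousOn_empty _, by simp, by simp⟩⟩
      (fun n f => ⟨next n f, hsep n f⟩) n
  have hF : ∀ m n, m ≤ n → EqOn (F n).1 (F m).1 (skel X m) := by
    intro m n hmn
    induction n, hmn using Nat.le_induction with
    | base => exact fun _ _ => rfl
    | succ n hmn ih =>
      intro x hx
      exact (hnext n (F n) (skeletonLT_mono (by exact_mod_cast hmn) hx)).trans (ih hx)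
  have hex : ∀ x : X, ∃ n, x ∈ skel X n := fun x => by
    have hx : x ∈ ⋃ (n : ℕ) (j : cell (univ : Set X) n), closedCell n j := by
      rw [CWComplex.union]
      trivial
    simp only [mem_iUnion] at hx
    obtain ⟨n, j, hx⟩ := hx
    exact ⟨n + 1, closedCell_subset_skeletonLT n j hx⟩
  let f : X → ℝ := fun x => (F (Nat.find (hex x))).1 x
  have hf : ∀ n, EqOn f (F n).1 (skel X n) := fun n x hx =>
    (hF _ n (Nat.find_min' (hex x) hx) (Nat.find_spec (hex x))).symm
  refine ⟨f, continuousOn_univ.2 ?_, ?_, ?_⟩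
  · refine continuous_iff_isClosed.2 fun Z hZ => ?_
    rw [CWComplex.closed (univ : Set X) _ (subset_univ _)]
    intro n j
    have hsub : closedCell n j ⊆ skel X (n + 1) := closedCell_subset_skeletonLT n j
    have : f ⁻¹' Z ∩ closedCell n j = (skel X (n + 1) ∩ (F (n + 1)).1 ⁻¹' Z) ∩ closedCell n j := by
      ext x
      constructor
      · rintro ⟨h1, h3⟩
        exact ⟨⟨hsub h3, by rw [mem_preimage, ← hf _ (hsub h3)]; exact h1⟩, h3⟩
      · rintro ⟨⟨h1, h2⟩, h3⟩
        exact ⟨by rw [mem_preimage, hf _ h1]; exact h2, h3⟩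
    rw [this]
    exact ((F (n + 1)).2.continuousOn.preimage_isClosed_of_isClosed (isClosed_skel _) hZ).inter
      isClosed_closedCell
  · rintro x ⟨hxs, -⟩
    obtain ⟨n, hn⟩ := hex x
    rw [hf n hn]
    exact (F n).2.eq_zero x ⟨hxs, hn⟩
  · rintro x ⟨hxs, -⟩
    obtain ⟨n, hn⟩ := hex x
    rw [hf n hn]
    exact (F n).2.eq_one x ⟨hxs, hn⟩

/-- A CW complex is a normal space. -/
theorem normalSpace : NormalSpace X where
  normal s t hs ht hst := by
    obtain ⟨f, hf, h0, h1⟩ := exists_separatesOn_univ hs ht hst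
    rw [continuousOn_univ] at hf
    refine ⟨f ⁻¹' Iio (1 / 2), f ⁻¹' Ioi (1 / 2), isOpen_Iio.preimage hf, isOpen_Ioi.preimage hf,
      fun x hx => ?_, fun x hx => ?_, ?_⟩
    · simp [h0 x ⟨hx, trivial⟩]
    · simp only [mem_preimage, mem_Ioi, h1 x ⟨hx, trivial⟩]
      norm_num
    · exact Disjoint.preimage f (Set.disjoint_left.2 fun a (ha : a < 1 / 2) hb => lt_asymm ha hb)

end CWNormal

/-! ### Distributions as weighted families of points -/

namespace DistCat

open Topology Filter BoundedContinuousFunction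
open scoped NNReal

universe u v w

namespace Distribution

variable {n : ℕ} {Z : Type u} [TopologicalSpace Z]

/-- The integral of a bounded continuous function against a distribution. -/
noncomputable def integral (μ : Distribution n Z) (F : Z →ᵇ ℝ) : ℝ :=
  letI : MeasurableSpace Z := borel Z
  ∫ z, F z ∂(μ.1 : Measure Z)

/-- `μ` is the formal sum of the point masses `a i • δ (z i)`. -/
def IsSum (μ : Distribution n Z) (a : Fin n → ℝ≥0) (z : Fin n → Z) : Prop :=
  (μ.1 : @Measure Z (borel Z)) = ∑ i, a i • @Measure.dirac Z (borel Z) (z i)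

theorem exists_isSum (μ : Distribution n Z) : ∃ a z, μ.IsSum a z := μ.2

theorem IsSum.sum_eq_one {μ : Distribution n Z} {a : Fin n → ℝ≥0} {z : Fin n → Z}
    (h : μ.IsSum a z) : ∑ i, a i = 1 := by
  let _ : MeasurableSpace Z := borel Z
  have h1 : (μ.1 : Measure Z) Set.univ = 1 := measure_univ
  rw [h, Measure.finsetSum_apply] at h1
  simp only [Measure.smul_apply, measure_univ, ENNReal.smul_def, smul_eq_mul, mul_one] at h1
  exact_mod_cast h1

theorem IsSum.integral_eq {μ : Distribution n Z} {a : Fin n → ℝ≥0} {z : Fin n → Z}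
    (h : μ.IsSum a z) (F : Z →ᵇ ℝ) : μ.integral F = ∑ i, (a i : ℝ) * F (z i) := by
  let _ : MeasurableSpace Z := borel Z
  have : BorelSpace Z := ⟨rfl⟩
  have hF : StronglyMeasurable F := F.continuous.stronglyMeasurable
  rw [integral, h, integral_finsetSum_measure]
  · refine Finset.sum_congr rfl fun i _ => ?_
    rw [integral_smul_nnreal_measure, integral_dirac' _ _ hF]
    rfl
  · exact fun i _ => F.integrable _

theorem IsSum.mem_supp {μ : Distribution n Z} {a : Fin n → ℝ≥0} {z : Fin n → Z}
    (h : μ.IsSum a z) {i : Fin n} (hi : a i ≠ 0) : z i ∈ μ.supp := by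
  let _ : MeasurableSpace Z := borel Z
  intro h0
  change (μ.1 : Measure Z) {z i} = 0 at h0
  rw [h, Measure.finsetSum_apply, Finset.sum_eq_zero_iff] at h0
  have h2 := h0 i (Finset.mem_univ i)
  rw [Measure.smul_apply, Measure.dirac_apply_of_mem (Set.mem_singleton _)] at h2
  exact hi (by simpa [ENNReal.smul_def] using h2)

/-- Singletons are Borel in a T1 space, so a point mass elsewhere contributes nothing to `{x}`. -/
theorem IsSum.exists_of_mem_supp [T1Space Z] {μ : Distribution n Z} {a : Fin n → ℝ≥0}
    {z : Fin n → Z} (h : μ.IsSum a z) {x : Z} (hx : x ∈ μ.supp) : ∃ i, a i ≠ 0 ∧ z i = x := by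
  let _ : MeasurableSpace Z := borel Z
  have : BorelSpace Z := ⟨rfl⟩
  by_contra! hcon
  refine hx ?_
  rw [h, Measure.finsetSum_apply]
  refine Finset.sum_eq_zero fun i _ => ?_
  by_cases hi : a i = 0
  · simp [hi]
  · rw [Measure.smul_apply, Measure.dirac_apply' _ (measurableSet_singleton x),
      Set.indicator_of_notMem (show z i ∉ ({x} : Set Z) from fun hm => hcon i hi hm), smul_zero]

/-- The distribution with weights `a i` at the points `z i`. -/
theorem exists_of_weights {a : Fin n → ℝ≥0} (ha : ∑ i, a i = 1) (z : Fin n → Z) :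
    ∃ μ : Distribution n Z, μ.IsSum a z := by
  let _ : MeasurableSpace Z := borel Z
  have hp : IsProbabilityMeasure (∑ i, a i • Measure.dirac (z i)) := by
    constructor
    rw [Measure.finsetSum_apply]
    simp only [Measure.smul_apply, measure_univ, ENNReal.smul_def, smul_eq_mul, mul_one]
    exact_mod_cast ha
  exact ⟨⟨⟨_, hp⟩, a, z, rfl⟩, rfl⟩

theorem tendsto_iff {A : Type*} {l : Filter A} {g : A → Distribution n Z} {μ : Distribution n Z} :
    Tendsto g l (𝓝 μ) ↔ ∀ F : Z →ᵇ ℝ, Tendsto (fun y => (g y).integral F) l (𝓝 (μ.integral F)) := by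
  let _ : MeasurableSpace Z := borel Z
  have : BorelSpace Z := ⟨rfl⟩
  have hi : IsInducing (fun μ : Distribution n Z => (μ.1 : ProbabilityMeasure Z)) := ⟨rfl⟩
  rw [hi.tendsto_nhds_iff, ProbabilityMeasure.tendsto_iff_forall_integral_tendsto]
  rfl

theorem continuous_iff {A : Type*} [TopologicalSpace A] {g : A → Distribution n Z} :
    Continuous g ↔ ∀ F : Z →ᵇ ℝ, Continuous fun y => (g y).integral F := by
  simp only [continuous_iff_continuousAt, ContinuousAt, tendsto_iff]
  exact forall_comm

end Distribution

section Lifts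

variable {E : Type u} {B : Type v} {A : Type w} [TopologicalSpace E] [TopologicalSpace B]
  [TopologicalSpace A]

/-- A lift along `pₙ` amounts to a weakly continuous choice of `n` weighted points in each fibre. -/
theorem hasDistLift_iff [T1Space E] {p : C(E, B)} {n : ℕ} {f : C(A, B)} :
    HasDistLift p n f ↔ ∃ (a : A → Fin n → ℝ≥0) (z : A → Fin n → E), (∀ y, ∑ i, a y i = 1) ∧
      (∀ y i, a y i ≠ 0 → p (z y i) = f y) ∧
      ∀ F : E →ᵇ ℝ, Continuous fun y => ∑ i, (a y i : ℝ) * F (z y i) := by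
  constructor
  · rintro ⟨g, hg⟩
    -- The weights and points are chosen without continuity in `y`; only their sums against test
    -- functions are continuous.
    choose a z haz using fun y => (g y).1.exists_isSum
    refine ⟨a, z, fun y => (haz y).sum_eq_one, fun y i hi => ?_, fun F => ?_⟩
    · exact (FiberDistribution.proj_eq_iff _ _).1 (hg y) ((haz y).mem_supp hi)
    · simp_rw [← (haz _).integral_eq]
      exact Distribution.continuous_iff.1 (continuous_subtype_val.comp g.continuous) F
  · rintro ⟨a, z, ha, hz, hF⟩
    choose g hg using fun y => Distribution.exists_of_weights (ha y) (z y)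
    have hsupp : ∀ y, (g y).supp ⊆ p ⁻¹' {f y} := fun y x hx => by
      obtain ⟨i, hi, rfl⟩ := (hg y).exists_of_mem_supp hx
      exact hz y i hi
    have hc : Continuous g := Distribution.continuous_iff.2 fun F => by
      simp_rw [(hg _).integral_eq]
      exact hF F
    exact ⟨⟨fun y => ⟨g y, f y, hsupp y⟩, hc.subtype_mk _⟩,
      fun y => (FiberDistribution.proj_eq_iff _ _).2 (hsupp y)⟩

/-- Lifts are pushed forward along maps of spaces over a base. -/
theorem HasDistLift.map {E' : Type*} {B' : Type*} [TopologicalSpace E'] [TopologicalSpace B']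
    [T1Space E] [T1Space E'] {p : C(E, B)} {p' : C(E', B')} {m : C(E, E')} {k : C(B, B')}
    (hm : ∀ x, p' (m x) = k (p x)) {n : ℕ} {f : C(A, B)} (h : HasDistLift p n f) :
    HasDistLift p' n (k.comp f) := by
  obtain ⟨a, z, ha, hz, hF⟩ := hasDistLift_iff.1 h
  refine hasDistLift_iff.2 ⟨a, fun y i => m (z y i), ha, fun y i hi => ?_, fun F => ?_⟩
  · rw [hm, hz y i hi]
    rfl
  · exact hF (F.compContinuous m)

theorem distLiftNumber_congr {E' : Type*} {B' : Type*} {A' : Type*} [TopologicalSpace E']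
    [TopologicalSpace B'] [TopologicalSpace A'] {p : C(E, B)} {p' : C(E', B')} {f : C(A, B)}
    {f' : C(A', B')} (h : ∀ n, HasDistLift p n f ↔ HasDistLift p' n f') :
    distLiftNumber p f = distLiftNumber p' f' := by
  simp only [distLiftNumber, h]

end Lifts

end DistCat

/-! ### Coverings with contractible total space -/

namespace DistCat

open Topology unitInterval

section Coverings

variable {E E' B : Type*} [TopologicalSpace E] [TopologicalSpace E'] [TopologicalSpace B]

theorem t2Space_of_isCoveringMap [T2Space B] {p : E → B} (hp : IsCoveringMap p) : T2Space E where
  t2 x y hxy := by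
    by_cases h : p x = p y
    · exact hp.isSeparatedMap x y h hxy
    · exact separated_by_continuous hp.continuous h

theorem surjective_of_isCoveringMap [PathConnectedSpace B] [Nonempty E] {p : E → B}
    (hp : IsCoveringMap p) : Function.Surjective p := fun b => by
  obtain ⟨e⟩ := ‹Nonempty E›
  let γ : Path (p e) b := PathConnectedSpace.somePath _ _
  obtain ⟨Γ, hΓ, -⟩ := hp.exists_path_lifts γ.toContinuousMap e γ.source
  exact ⟨Γ 1, (congrFun hΓ 1).trans γ.target⟩

/-- A map over `B` from a path connected covering space of `B` to a simply connected one is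
bijective. -/
theorem bijective_of_isCoveringMap [PathConnectedSpace E] [SimplyConnectedSpace E'] {p : E → B}
    {p' : E' → B} (hp : IsCoveringMap p) (hp' : IsCoveringMap p') {g : C(E, E')}
    (hg : ∀ e, p' (g e) = p e) : Function.Bijective g := by
  constructor
  -- The image in `E'` of a path from `e₁` to `e₂` is a null-homotopic loop. Its projection to `B`
  -- is then null-homotopic rel end points, so the lift to `E` closes up.
  · intro e₁ e₂ he
    let γ : Path e₁ e₂ := PathConnectedSpace.somePath _ _
    have hh : ((γ.map g.continuous).cast rfl he).Homotopic (Path.refl (g e₁)) :=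
      SimplyConnectedSpace.paths_homotopic _ _
    have h1 : (g.comp γ.toContinuousMap).HomotopicRel (g.comp (.const I e₁)) {0, 1} := hh
    have h2 : (ContinuousMap.comp ⟨p', hp'.continuous⟩ (g.comp γ.toContinuousMap)).HomotopicRel
        (.comp ⟨p', hp'.continuous⟩ (g.comp (.const I e₁))) {0, 1} :=
      h1.map fun F => F.compContinuousMap _
    have h3 := hp.liftPath_apply_one_eq_of_homotopicRel h2 e₁
      (by simp [hg]) (by simp [hg])
    have e1 := (hp.eq_liftPath_iff' (Γ := γ.toContinuousMap) (e := e₁)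
      (γ := ContinuousMap.comp ⟨p', hp'.continuous⟩ (g.comp γ.toContinuousMap)) (by simp [hg])).2
      ⟨by ext t; simp [hg], γ.source⟩
    have e2 := (hp.eq_liftPath_iff' (Γ := .const I e₁) (e := e₁)
      (γ := ContinuousMap.comp ⟨p', hp'.continuous⟩ (g.comp (.const I e₁))) (by simp [hg])).2
      ⟨by ext t; simp [hg], rfl⟩
    rw [← e1, ← e2] at h3
    exact (γ.target.symm.trans h3).symm
  · intro y
    obtain ⟨e⟩ := (inferInstance : Nonempty E)
    let γ : Path (g e) y := PathConnectedSpace.somePath _ _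
    obtain ⟨Γ, hΓ, hΓ0⟩ := hp.exists_path_lifts
      (ContinuousMap.comp ⟨p', hp'.continuous⟩ γ.toContinuousMap) e (by simp [hg])
    refine ⟨Γ 1, ?_⟩
    -- Both are lifts to `E'` of the same path in `B` with the same starting point.
    have h : g ∘ Γ = γ := by
      refine hp'.eq_of_comp_eq (g.continuous.comp Γ.continuous) γ.continuous ?_ 0 (by simp [hΓ0])
      ext t
      simpa [hg] using congrFun hΓ t
    exact (congrFun h 1).trans γ.target

theorem exists_contraction [ContractibleSpace E] (c : E) :
    ∃ H : C(I × E, E), (∀ e, H (0, e) = e) ∧ ∀ e, H (1, e) = c := by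
  obtain ⟨c', h⟩ := id_nullhomotopic E
  obtain ⟨H⟩ := h.trans (ContinuousMap.homotopic_const_iff.2 (PathConnectedSpace.joined c' c))
  exact ⟨H.toContinuousMap, H.apply_zero, H.apply_one⟩

/-- All universal covering spaces of a space with a contractible covering space are
contractible. -/
theorem contractibleSpace_of_isCoveringMap [PathConnectedSpace B] [ContractibleSpace E]
    [SimplyConnectedSpace E'] {p : E → B} {p' : E' → B} (hp : IsCoveringMap p)
    (hp' : IsCoveringMap p') : ContractibleSpace E' := by
  obtain ⟨c⟩ := (inferInstance : Nonempty E)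
  obtain ⟨H, H0, H1⟩ := exists_contraction c
  obtain ⟨x, hx⟩ := surjective_of_isCoveringMap hp' (p c)
  -- Reversing time makes the projected contraction start at a constant map, which lifts; the end of
  -- the lifted homotopy is a map `E → E'` over `B`.
  let G : C(I × E, B) := ⟨fun y => p (H (σ y.1, y.2)), hp.continuous.comp (by fun_prop)⟩
  have hG : ∀ e, G (0, e) = p' (ContinuousMap.const E x e) := fun e => by simp [G, H1, hx]
  let g : C(E, E') := (hp'.liftHomotopy G (.const E x) hG).comp ⟨fun e => (1, e), by fun_prop⟩
  have hg : ∀ e, p' (g e) = p e := fun e =>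
    (congrFun (hp'.liftHomotopy_lifts G (.const E x) hG) (1, e)).trans (by simp [G, H0])
  have hloc : IsLocalHomeomorph g := by
    refine IsLocalHomeomorph.of_comp (g := p') ?_ hp'.isLocalHomeomorph g.continuous
    rw [show p' ∘ g = p from funext hg]
    exact hp.isLocalHomeomorph
  exact (hloc.toHomeomorphOfBijective (bijective_of_isCoveringMap hp hp' hg)).symm.contractibleSpace

end Coverings

/-! ### Comparison of based paths with a covering -/

section BasedPath

variable {X : Type*} {E : Type*} [TopologicalSpace X] [TopologicalSpace E]

instance instT2SpaceBasedPath [T2Space X] (x₀ : X) : T2Space (BasedPath X x₀) :=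
  inferInstanceAs (T2Space {φ : C(I, X) // φ 1 = x₀})

/-- Lifting paths from their end points maps the based path space to any covering space. -/
theorem exists_basedPath_to_covering {q : C(E, X)} (hq : IsCoveringMap q) (e₀ : E) :
    ∃ m : C(BasedPath X (q e₀), E), ∀ φ, q (m φ) = evalZero X (q e₀) φ := by
  let P := BasedPath X (q e₀)
  -- Paths are run backwards because only their end point has a prescribed lift, `e₀`.
  have hc : Continuous fun y : I × P => y.2.1 (σ y.1) := by
    have h2 : Continuous fun y : I × P => (y.2.1, σ y.1) :=
      (continuous_subtype_val.comp continuous_snd).prodMk (by fun_prop)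
    exact ContinuousEval.continuous_eval.comp h2
  let G : C(I × P, X) := ⟨_, hc⟩
  have hG : ∀ φ, G (0, φ) = q (ContinuousMap.const P e₀ φ) := fun φ => by
    simpa [G] using φ.2
  refine ⟨(hq.liftHomotopy G (.const P e₀) hG).comp ⟨fun φ => (1, φ), by fun_prop⟩, fun φ => ?_⟩
  exact (congrFun (hq.liftHomotopy_lifts G (.const P e₀) hG) (1, φ)).trans (by simp [G, evalZero])

/-- A contraction of the space `E` over `X` maps it to the based path space of `X`. -/
theorem exists_contractible_to_basedPath [ContractibleSpace E] (q : C(E, X)) (e₀ : E) :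
    ∃ m : C(E, BasedPath X (q e₀)), ∀ e, evalZero X (q e₀) (m e) = q e := by
  obtain ⟨H, H0, H1⟩ := exists_contraction e₀
  let G : C(E, C(I, X)) := ContinuousMap.curry ⟨fun y : E × I => q (H (y.2, y.1)), by fun_prop⟩
  have hG : ∀ e, G e 1 = q e₀ := fun e => congrArg q (H1 e)
  refine ⟨⟨fun e => ⟨G e, hG e⟩, G.continuous.subtype_mk hG⟩, fun e => ?_⟩
  exact congrArg q (H0 e)

/-- The distributional category and one-category agree for maps to a space with a contractible
covering space. -/
theorem dcatOne_eq_dcat {Y : Type*} [TopologicalSpace Y] [T2Space X] [PathConnectedSpace X]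
    [ContractibleSpace E] {q : C(E, X)} (hq : IsCoveringMap q) (x₀ : X) (f : C(Y, X)) :
    dcatOne q f = dcat x₀ f := by
  have : T2Space E := t2Space_of_isCoveringMap hq
  obtain ⟨e₀, rfl⟩ := surjective_of_isCoveringMap hq x₀
  obtain ⟨m, hm⟩ := exists_contractible_to_basedPath q e₀
  obtain ⟨m', hm'⟩ := exists_basedPath_to_covering hq e₀
  exact distLiftNumber_congr fun n =>
    ⟨fun h => h.map (k := .id X) (m := m) hm, fun h => h.map (k := .id X) (m := m') hm'⟩

end BasedPath

end DistCat

/-! ### Lifts to pulled back coverings -/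

namespace DistCat

open Topology Filter BoundedContinuousFunction
open scoped NNReal

section Pullback

variable {E B : Type*} [TopologicalSpace E] [TopologicalSpace B]

/-- Over a neighbourhood of a point of a completely regular space, a covering has a family of local
sections `σ c` together with bump functions `ψ c` that are concentrated on their disjoint ranges. -/
theorem exists_sections_and_bumps [CompletelyRegularSpace B] {q : E → B} (hq : IsCoveringMap q)
    (e₀ : E) :
    ∃ (U : Set B) (σ : q ⁻¹' {q e₀} → B → E) (ψ : q ⁻¹' {q e₀} → (E →ᵇ ℝ)),
      IsOpen U ∧ q e₀ ∈ U ∧ (∀ c, ContinuousOn (σ c) U) ∧ (∀ c, ∀ b ∈ U, q (σ c b) = b) ∧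
      (∀ c x, ψ c x ≠ 0 → q x ∈ U ∧ σ c (q x) = x) ∧ (∀ c x, 0 ≤ ψ c x) ∧
      (∀ (S : Finset (q ⁻¹' {q e₀})) (x : E), ∑ c ∈ S, ψ c x ≤ 1) ∧
      ∀ x, q x = q e₀ → ∃ c, ψ c x = 1 := by
  classical
  have hn : Nonempty (q ⁻¹' {q e₀}) := ⟨⟨e₀, rfl⟩⟩
  have hd := (hq (q e₀)).discreteTopology_fiber
  let t := (hq (q e₀)).toTrivialization
  have hb : q e₀ ∈ t.baseSet := (hq (q e₀)).mem_toTrivialization_baseSet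
  obtain ⟨φ, hφc, hφ0, hφ1⟩ := CompletelyRegularSpace.completely_regular (q e₀) t.baseSetᶜ
    t.open_baseSet.isClosed_compl (fun h => h hb)
  -- `f` is one on the fibre over `q e₀` and zero off `t.source`; cutting it down to the sheets `V
  -- c` gives the bumps.
  let f : E → ℝ := fun x => 1 - (φ (q x) : ℝ)
  have hfc : Continuous f :=
    continuous_const.sub (continuous_subtype_val.comp (hφc.comp hq.continuous))
  have hf0 : ∀ x, 0 ≤ f x := fun x => sub_nonneg.2 (φ (q x)).2.2
  have hf1 : ∀ x, f x ≤ 1 := fun x => sub_le_self _ (φ (q x)).2.1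
  let V : q ⁻¹' {q e₀} → Set E := fun c => t.source ∩ (fun x => (t x).2) ⁻¹' {c}
  have hV : ∀ s : Set (q ⁻¹' {q e₀}), IsOpen (t.source ∩ (fun x => (t x).2) ⁻¹' s) := fun s =>
    (continuous_snd.comp_continuousOn t.continuousOn_toFun).isOpen_inter_preimage t.open_source
      (isOpen_discrete s)
  have hψc : ∀ c, Continuous ((V c).indicator f) := fun c => by
    refine continuous_indicator (fun x hx => ?_) hfc.continuousOn
    rw [(hV {c}).frontier_eq] at hx
    -- The sheets are open and partition `t.source`, so a sheet has no frontier there, and elsewhere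
    -- `f` vanishes.
    have hxs : x ∉ t.source := fun hs => by
      obtain ⟨y, hy, hy'⟩ := mem_closure_iff.1 hx.1 _ (hV {c}ᶜ) ⟨hs, fun h => hx.2 ⟨hs, h⟩⟩
      exact hy.2 hy'.2
    have : φ (q x) = 1 := hφ1 (fun h => hxs (t.mem_source.2 h))
    simp [f, this]
  have hψ0 : ∀ c x, 0 ≤ (V c).indicator f x := fun c x => Set.indicator_nonneg (fun y _ => hf0 y) x
  have hψ1 : ∀ c x, (V c).indicator f x ≤ 1 := fun c x =>
    (Set.indicator_le_self' (fun y _ => hf0 y) x).trans (hf1 x)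
  refine ⟨t.baseSet, fun c b => t.invFun (b, c), fun c => ofNormedAddCommGroup _ (hψc c) 1
    fun x => by rw [Real.norm_of_nonneg (hψ0 c x)]; exact hψ1 c x, t.open_baseSet, hb,
    fun c => ?_, fun c b hb => t.proj_symm_apply' hb, fun c x hx => ?_, hψ0, fun S x => ?_,
    fun x hx => ?_⟩
  · refine t.continuousOn_invFun.comp (Continuous.prodMk_left c).continuousOn fun b hb => ?_
    rw [t.target_eq]
    exact ⟨hb, trivial⟩
  · have hxV : x ∈ V c :=
      Set.mem_of_indicator_ne_zero (show (V c).indicator f x ≠ 0 from hx)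
    refine ⟨t.mem_source.1 hxV.1, ?_⟩
    rw [← show (t x).2 = c from hxV.2]
    exact t.symm_apply_mk_proj hxV.1
  -- At most one sheet contains `x`, so at most one summand is nonzero.
  · by_cases hm : (t x).2 ∈ S
    · refine (Finset.sum_eq_single_of_mem _ hm fun c _ hc => ?_).trans_le (hψ1 _ x)
      change (V c).indicator f x = 0
      exact Set.indicator_of_notMem (fun h => hc (Eq.symm h.2)) _
    · refine (Finset.sum_eq_zero fun c hc => ?_).trans_le zero_le_one
      change (V c).indicator f x = 0
      exact Set.indicator_of_notMem
        (fun h : x ∈ V c => hm (by rwa [show (t x).2 = c from h.2])) _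
  · refine ⟨(t x).2, ?_⟩
    have hxV : x ∈ V (t x).2 := ⟨t.mem_source.2 (by rwa [hx]), rfl⟩
    refine (Set.indicator_of_mem hxV f).trans ?_
    simp [f, hx, hφ0]

variable {Y : Type*} [TopologicalSpace Y]

/-- Weighted points in the fibres of a covering that vary weakly continuously also vary weakly
continuously as points of the pulled back covering. -/
theorem continuous_pullback [CompletelyRegularSpace B] {q : C(E, B)} (hq : IsCoveringMap q)
    {κ : C(Y, B)} {n : ℕ} {a : Y → Fin n → ℝ≥0} {z : Y → Fin n → E}
    {w : Y → Fin n → {x : Y × E // κ x.1 = q x.2}} (ha : ∀ y, ∑ i, a y i = 1)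
    (hw : ∀ y i, a y i ≠ 0 → (w y i).1 = (y, z y i))
    (hF : ∀ F : E →ᵇ ℝ, Continuous fun y => ∑ i, (a y i : ℝ) * F (z y i))
    (F : {x : Y × E // κ x.1 = q x.2} →ᵇ ℝ) :
    Continuous fun y => ∑ i, (a y i : ℝ) * F (w y i) := by
  classical
  have ha' : ∀ y, ∑ i, (a y i : ℝ) = 1 := fun y => by exact_mod_cast ha y
  have hz : ∀ y i, a y i ≠ 0 → κ y = q (z y i) := fun y i hi => by
    simpa [hw y i hi] using (w y i).2
  refine continuous_iff_continuousAt.2 fun y₀ => ?_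
  obtain ⟨i₀, hi₀⟩ : ∃ i, a y₀ i ≠ 0 := by
    by_contra! h
    simpa [h] using ha y₀
  obtain ⟨U, σ, ψ, hU, hbU, hσc, hσ, hψσ, hψ0, hψ1, hψb⟩ :=
    exists_sections_and_bumps hq (z y₀ i₀)
  have hψ : ∀ i, ∃ c, a y₀ i ≠ 0 → ψ c (z y₀ i) = 1 := fun i => by
    by_cases hi : a y₀ i = 0
    · exact ⟨⟨z y₀ i₀, rfl⟩, fun h => absurd hi h⟩
    · obtain ⟨c, hc⟩ := hψb _ ((hz y₀ i hi).symm.trans (hz y₀ i₀ hi₀))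
      exact ⟨c, fun _ => hc⟩
  choose c hc using hψ
  -- The sheets that carry the mass at `y₀`, each counted once; finiteness keeps the sums below
  -- continuous even for infinitely many sheets.
  let S := Finset.univ.image c
  -- The value of `F` at the point over `y` on sheet `c`. The default `0` never contributes, since
  -- the bumps vanish over the complement of `U`.
  let G : q ⁻¹' {q (z y₀ i₀)} → Y → ℝ := fun c y =>
    if h : κ y ∈ U then F ⟨(y, σ c (κ y)), (hσ c _ h).symm⟩ else 0
  have hG : ∀ c, ContinuousAt (G c) y₀ := fun c => by
    have hy₀ : κ y₀ ∈ U := by rwa [hz y₀ i₀ hi₀]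
    refine ContinuousOn.continuousAt (s := κ ⁻¹' U) ?_ ((hU.preimage κ.continuous).mem_nhds hy₀)
    rw [continuousOn_iff_continuous_domRestrict]
    have h1 : Continuous fun y : κ ⁻¹' U => σ c (κ y) :=
      (hσc c).comp_continuous (κ.continuous.comp continuous_subtype_val) fun y => y.2
    have h2 : Continuous fun y : κ ⁻¹' U =>
        (⟨(y.1, σ c (κ y)), (hσ c _ y.2).symm⟩ : {x : Y × E // κ x.1 = q x.2}) :=
      (continuous_subtype_val.prodMk h1).subtype_mk _
    refine (F.continuous.comp h2).congr fun y => ?_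
    change _ = G c y.1
    simp only [G]
    rw [dif_pos (show κ y.1 ∈ U from y.2)]
    rfl
  let N : Y → ℝ := fun y => ∑ i, (a y i : ℝ) * F (w y i)
  let Ψ : Y → ℝ := fun y => ∑ c ∈ S, ∑ i, (a y i : ℝ) * ψ c (z y i)
  let Θ : Y → ℝ := fun y => ∑ c ∈ S, (∑ i, (a y i : ℝ) * ψ c (z y i)) * G c y
  have hΨc : ContinuousAt Ψ y₀ :=
    (continuous_finsetSum _ fun c _ => hF (ψ c)).continuousAt
  have hΘc : ContinuousAt Θ y₀ :=
    tendsto_finsetSum _ fun c _ => ((hF (ψ c)).continuousAt (x := y₀)).mul (hG c)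
  have hΨ₀ : Ψ y₀ = 1 := by
    simp only [Ψ]
    rw [Finset.sum_comm, ← ha' y₀]
    refine Finset.sum_congr rfl fun i _ => ?_
    rw [← Finset.mul_sum]
    by_cases hi : a y₀ i = 0
    · simp [hi]
    · rw [(hψ1 S (z y₀ i)).antisymm, mul_one]
      rw [← hc i hi]
      exact Finset.single_le_sum (f := fun c => ψ c (z y₀ i)) (fun c _ => hψ0 c _)
        (Finset.mem_image_of_mem c (Finset.mem_univ i))
  have hterm : ∀ y i, a y i ≠ 0 → ∀ c, ψ c (z y i) * G c y = ψ c (z y i) * F (w y i) := by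
    intro y i hi c
    by_cases h0 : ψ c (z y i) = 0
    · simp [h0]
    · obtain ⟨h1, h2⟩ := hψσ c _ h0
      rw [← hz y i hi] at h1 h2
      simp only [G, dif_pos h1]
      have h3 : (⟨(y, σ c (κ y)), (hσ c _ h1).symm⟩ : {x : Y × E // κ x.1 = q x.2}) = w y i :=
        Subtype.ext ((congrArg (Prod.mk y) h2).trans (hw y i hi).symm)
      rw [h3]
  -- `Θ` replaces `F` by its values along the sheets, so the error comes only from the mass `1 - Ψ
  -- y` that the bumps miss, which tends to zero.
  have hbound : ∀ y, ‖N y - Θ y‖ ≤ ‖F‖ * (1 - Ψ y) := by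
    intro y
    have h1 : N y - Θ y =
        ∑ i, (a y i : ℝ) * ((1 - ∑ c ∈ S, ψ c (z y i)) * F (w y i)) := by
      simp only [N, Θ, Finset.sum_mul]
      rw [Finset.sum_comm, ← Finset.sum_sub_distrib]
      refine Finset.sum_congr rfl fun i _ => ?_
      by_cases hi : a y i = 0
      · simp [hi]
      · simp_rw [mul_assoc, hterm y i hi, ← Finset.mul_sum, ← Finset.sum_mul]
        ring
    have h2 : ‖F‖ * (1 - Ψ y) = ∑ i, (a y i : ℝ) * ((1 - ∑ c ∈ S, ψ c (z y i)) * ‖F‖) := by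
      simp only [Ψ, ← mul_assoc, ← Finset.sum_mul, mul_sub, mul_one, Finset.sum_sub_distrib, ha' y]
      rw [Finset.sum_comm, mul_comm]
      simp only [Finset.mul_sum, sub_mul, one_mul]
    rw [h1, h2]
    refine norm_sum_le_of_le _ fun i _ => ?_
    rw [norm_mul, norm_mul, Real.norm_of_nonneg (NNReal.coe_nonneg _),
      Real.norm_of_nonneg (sub_nonneg.2 (hψ1 S _))]
    have := sub_nonneg.2 (hψ1 S (z y i))
    gcongr
    exact F.norm_coe_le_norm _
  have hlim : Tendsto (fun y => N y - Θ y) (𝓝 y₀) (𝓝 0) := by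
    refine squeeze_zero_norm hbound ?_
    have := (tendsto_const_nhds (x := (1 : ℝ))).sub hΨc.tendsto |>.const_mul ‖F‖
    simpa [hΨ₀] using this
  have hΘ₀ : Θ y₀ = N y₀ := by
    have := hbound y₀
    rw [hΨ₀, sub_self, mul_zero, norm_le_zero_iff, sub_eq_zero] at this
    exact this.symm
  have h := hlim.add hΘc.tendsto
  simp only [sub_add_cancel, zero_add, hΘ₀] at h
  exact h

/-- A lift of `κ` to distributions on a covering gives a section of the distributions on the pulled
back covering. -/
theorem HasDistLift.pullback [CompletelyRegularSpace B] [T2Space B] [T2Space Y] {q : C(E, B)}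
    (hq : IsCoveringMap q) {κ : C(Y, B)} {n : ℕ} (h : HasDistLift q n κ) :
    HasDistLift (⟨fun x => x.1.1, by fun_prop⟩ : C({x : Y × E // κ x.1 = q x.2}, Y)) n
      (ContinuousMap.id Y) := by
  classical
  have : T2Space E := t2Space_of_isCoveringMap hq
  obtain ⟨a, z, ha, hz, hF⟩ := hasDistLift_iff.1 h
  -- The pair `(y, z y i)` is only known to lie in the pullback when its weight is nonzero. A
  -- weightless index borrows the point of an index `j` with nonzero weight.
  have hex : ∀ y i, ∃ x : {x : Y × E // κ x.1 = q x.2}, a y i ≠ 0 → x.1 = (y, z y i) := by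
    intro y i
    obtain ⟨j, hj⟩ : ∃ j, a y j ≠ 0 := by
      by_contra! h
      simpa [h] using ha y
    by_cases hi : a y i = 0
    · exact ⟨⟨(y, z y j), (hz y j hj).symm⟩, fun h => absurd hi h⟩
    · exact ⟨⟨(y, z y i), (hz y i hi).symm⟩, fun _ => rfl⟩
  choose w hw using hex
  exact hasDistLift_iff.2 ⟨a, w, ha, fun y i hi => congrArg Prod.fst (hw y i hi),
    continuous_pullback hq ha hw hF⟩

/-- The one-category of a map that classifies the universal covering is that of its source. -/
theorem dcatOne_id_eq_of_classifies {Y' : Type*} [TopologicalSpace Y'] [CompletelyRegularSpace B]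
    [T2Space B] [T2Space Y] {q : C(E, B)} (hq : IsCoveringMap q) {qY : C(Y', Y)} {κ : C(Y, B)}
    (h : ClassifiesUniversalCovering qY q κ) : dcatOne qY (ContinuousMap.id Y) = dcatOne q κ := by
  have : T2Space E := t2Space_of_isCoveringMap hq
  obtain ⟨e, he⟩ := h
  have : T2Space Y' := e.symm.t2Space
  refine distLiftNumber_congr fun n => ⟨fun hl => ?_, fun hl => ?_⟩
  · refine hl.map (k := κ) (m := ⟨fun x => (e x).1.2, by fun_prop⟩) fun x => ?_
    exact (e x).2.symm.trans (congrArg κ (he x))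
  · refine (hl.pullback hq).map (k := .id Y) (m := ⟨e.symm, e.symm.continuous⟩) fun x => ?_
    exact (he (e.symm x)).symm.trans (by simp)

end Pullback

end DistCat

/-! ### The main theorem -/

theorem mainTheorem8 {π : Type*} [Group π]
    {Y K Y' K' : Type*} [TopologicalSpace Y] [TopologicalSpace K]
    [TopologicalSpace Y'] [TopologicalSpace K']
    [T2Space Y] [ConnectedSpace Y] [Topology.CWComplex (Set.univ : Set Y)]
    [T2Space K] [ConnectedSpace K] [Topology.CWComplex (Set.univ : Set K)]
    (hK : DistCat.IsEilenbergMacLaneOne π K) (k₀ : K)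
    (qY : C(Y', Y)) (hqY : DistCat.IsUniversalCovering qY)
    (qK : C(K', K)) (hqK : DistCat.IsUniversalCovering qK) :
    (∀ κ : C(Y, K), DistCat.ClassifiesUniversalCovering qY qK κ →
      DistCat.dcatOne qY (ContinuousMap.id Y) = DistCat.dcatOne qK κ ∧
      DistCat.dcatOne qK κ = DistCat.dcat k₀ κ) ∧
    (∀ f : C(Y, K), DistCat.dcatOne qK f = DistCat.dcat k₀ f) ∧
    DistCat.dcatOne qK (ContinuousMap.id K) = DistCat.dcat k₀ (ContinuousMap.id K) := by
  have : NormalSpace K := CWNormal.normalSpace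
  have : PathConnectedSpace K := hK.pathConnectedSpace
  have : SimplyConnectedSpace K' := hqK.simplyConnectedSpace
  obtain ⟨E, _, q, hq, _⟩ := hK.contractible_cover
  -- The contractible covering `E` supplied by `hK` need not be the given `K'`.
  have : ContractibleSpace K' :=
    DistCat.contractibleSpace_of_isCoveringMap hq.isCoveringMap hqK.isCoveringMap
  exact ⟨fun κ hκ => ⟨DistCat.dcatOne_id_eq_of_classifies hqK.isCoveringMap hκ,
      DistCat.dcatOne_eq_dcat hqK.isCoveringMap k₀ κ⟩,
    fun f => DistCat.dcatOne_eq_dcat hqK.isCoveringMap k₀ f,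
    DistCat.dcatOne_eq_dcat hqK.isCoveringMap k₀ _⟩
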